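/- Consider $n$ robots indexed by $1,\dots,n$, whose communication graph at time $t\ge t_0$ is an undirected simple graph $G(t)$; let $\mathcal N_i(t)$ be the set of neighbors of robot $i$ in $G(t)$, and write $\mathrm{ave}_{j\in\mathcal N_i(t)}(a_j)$ for the arithmetic mean of the numbers $a_j$, $j\in\mathcal N_i(t)$. The graph may change arbitrarily over time. Let $\eta:[t_0,\infty)\to\mathbb R$ be a time-varying quantity, continuous, and differentiable at all times outside a countable set (for example, any differentiable function), which is known to a single robot $l$, and let $k_\eta>0$. Each robot $i$ computes an estimate $\hat\eta_i$ of $\eta$ by the algorithm $$\dot{\hat\eta}_i=\begin{cases}\dot\eta+k_\eta(\eta-\hat\eta_i), & i=l,\\[2pt] \mathrm{ave}_{j\in\mathcal N_i(t)}(\dot{\hat\eta}_j)+k_\eta\bigl(\mathrm{ave}_{j\in\mathcal N_i(t)}(\hat\eta_j)-\hat\eta_i\bigr), & i\ne l,\end{cases}$$ where a solution consists of continuous functions $\hat\eta_1,\dots,\hat\eta_n$ on $[t_0,\infty)$ for which, at all times $t>t_0$ outside a countable set, all derivatives in these equations exist and the equations hold. If $G(t)$ is connected for every $t\ge t_0$,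 then for every choice of initial estimates $\hat\eta_1(t_0),\dots,\hat\eta_n(t_0)\in\mathbb R$ the algorithm has a solution, and for every solution, whatever its initial estimates, $$\lim_{t\to\infty}\bigl(\hat\eta_i(t)-\eta(t)\bigr)=0,\qquad i=1,\dots,n.$$ -/

import Mathlib

open Set Filter Topology

/-- The average `ave_{j ∈ N_i} (f j)` of `f` over the neighbor set `N_i = {j | G.Adj i j}` of
robot `i` in the communication graph `G`. -/
noncomputable def neighborAverage {n : ℕ} (G : SimpleGraph (Fin n)) (i : Fin n)
    (f : Fin n → ℝ) : ℝ :=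
  open Classical in
  (∑ j ∈ G.neighborFinset i, f j) / (G.degree i : ℝ)

/-- The (implicit) consensus-tracking estimator at time `t`, with communication graph `G`,
informed robot `l`, gain `k`, global quantity `η` and estimates `x i` of `η`:
the informed robot tracks `η` directly, every other robot tracks the average of its neighbors.
All derivatives that occur are required to exist. -/
def EstimatorEquationAt {n : ℕ} (G : SimpleGraph (Fin n)) (l : Fin n) (k : ℝ)
    (η : ℝ → ℝ) (x : Fin n → ℝ → ℝ) (t : ℝ) : Prop :=
  DifferentiableAt ℝ η t ∧ (∀ i, DifferentiableAt ℝ (x i) t) ∧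
  ∀ i, deriv (x i) t =
    if i = l then deriv η t + k * (η t - x i t)
    else neighborAverage G i (fun j => deriv (x j) t) +
      k * (neighborAverage G i (fun j => x j t) - x i t)

/-- The estimates `x` are a solution on `[t₀, ∞)` of the consensus-tracking estimator over the
time-varying communication graph `G`: they are continuous, and satisfy the estimator equation at
all times except possibly countably many (such as the instants at which the graph switches). -/
structure IsEstimatorSolution {n : ℕ} (G : ℝ → SimpleGraph (Fin n)) (l : Fin n) (k : ℝ)
    (η : ℝ → ℝ) (t₀ : ℝ) (x : Fin n → ℝ → ℝ) : Prop where
  continuousOn : ∀ i, ContinuousOn (x i) (Ici t₀)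
  equation : ∃ S : Set ℝ, S.Countable ∧ ∀ t ∈ Ioi t₀ \ S, EstimatorEquationAt (G t) l k η x t

/-! At a fixed time, put `f j = deriv (x j) t + k * x j t`. The estimator says that `f` is harmonic
away from `l`, so on a connected graph the maximum principle (`eq_of_harmonic_off`) makes it
constant, equal to `η' + k η`. Each error `x i - η` thus satisfies `e' = -k e` off a countable set,
however the graph switches, and decays exponentially. Conversely, adding such exponentials to `η`
gives the solutions. -/

/-- The neighbor average satisfies the equation `deg i * ave = ∑ f` when `i` has a neighbor. -/
theorem degree_mul_neighborAverage {n : ℕ} (G : SimpleGraph (Fin n)) {i j : Fin n}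
    (h : G.Adj i j) (f : Fin n → ℝ) : open Classical in
    (G.degree i : ℝ) * neighborAverage G i f = ∑ j ∈ G.neighborFinset i, f j := by
  classical
  have hd : (G.degree i : ℝ) ≠ 0 := by
    have : 0 < G.degree i := (G.degree_pos_iff_exists_adj i).2 ⟨j, h⟩
    exact_mod_cast this.ne'
  unfold neighborAverage
  convert mul_div_cancel₀ _ hd using 2

theorem neighborAverage_add_mul {n : ℕ} (G : SimpleGraph (Fin n)) (i : Fin n) (k : ℝ)
    (f g : Fin n → ℝ) :
    neighborAverage G i (fun j => f j + k * g j) =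
      neighborAverage G i f + k * neighborAverage G i g := by
  classical
  unfold neighborAverage
  rw [Finset.sum_add_distrib, ← Finset.mul_sum, add_div, mul_div_assoc]

theorem neighborAverage_neg {n : ℕ} (G : SimpleGraph (Fin n)) (i : Fin n) (f : Fin n → ℝ) :
    neighborAverage G i (fun j => -f j) = -neighborAverage G i f := by
  classical
  unfold neighborAverage
  rw [Finset.sum_neg_distrib, neg_div]

theorem neighborAverage_const {n : ℕ} (G : SimpleGraph (Fin n)) {i j : Fin n}
    (h : G.Adj i j) (c : ℝ) : neighborAverage G i (fun _ => c) = c := by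
  classical
  have hd : (G.degree i : ℝ) ≠ 0 := by
    have : 0 < G.degree i := (G.degree_pos_iff_exists_adj i).2 ⟨j, h⟩
    exact_mod_cast this.ne'
  have := degree_mul_neighborAverage G h (fun _ => c)
  rw [Finset.sum_const, G.card_neighborFinset_eq_degree, nsmul_eq_mul] at this
  apply mul_left_cancel₀ hd
  convert this

/-- Where the neighbor average attains an upper bound of `f`, so does `f` at every neighbor. -/
theorem eq_of_neighborAverage_eq_of_le {n : ℕ} (G : SimpleGraph (Fin n)) {i j : Fin n}
    (h : G.Adj i j) {f : Fin n → ℝ} {M : ℝ} (hM : ∀ a, f a ≤ M)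
    (hf : neighborAverage G i f = M) : f j = M := by
  classical
  have hs := degree_mul_neighborAverage G h f
  have hc := degree_mul_neighborAverage G h (fun _ => M)
  rw [neighborAverage_const G h] at hc
  rw [hf, hc] at hs
  exact (Finset.sum_eq_sum_iff_of_le (fun a _ => hM a)).1 hs.symm j (by simpa using h)

/-- Maximum principle: a function harmonic away from `l` on a connected graph is at most its
value at `l`. -/
theorem le_of_harmonic_off {n : ℕ} {G : SimpleGraph (Fin n)} (hG : G.Connected) (l : Fin n)
    {f : Fin n → ℝ} (hf : ∀ i, i ≠ l → f i = neighborAverage G i f) (i : Fin n) :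
    f i ≤ f l := by
  have : Nonempty (Fin n) := ⟨l⟩
  obtain ⟨m, hm⟩ := Finite.exists_max f
  -- The maximum spreads along a walk towards `l`. Harmonicity fails at `l`, so the argument stops
  -- on first reaching it.
  have key : ∀ {a b : Fin n}, G.Walk a b → b = l → f a = f m → f l = f m := by
    intro a b p
    induction p with
    | nil => rintro rfl h; exact h
    | @cons u v w huv _ ih =>
      intro hw hu
      by_cases hul : u = l
      · rwa [hul] at hu
      · exact ih hw (eq_of_neighborAverage_eq_of_le G huv hm ((hf u hul).symm.trans hu))
  obtain ⟨p⟩ := hG.preconnected m l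
  rw [key p rfl rfl]
  exact hm i

/-- The maximum principle for `f` and for `-f`. -/
theorem eq_of_harmonic_off {n : ℕ} {G : SimpleGraph (Fin n)} (hG : G.Connected) (l : Fin n)
    {f : Fin n → ℝ} (hf : ∀ i, i ≠ l → f i = neighborAverage G i f) (i : Fin n) :
    f i = f l := by
  refine le_antisymm (le_of_harmonic_off hG l hf i) (neg_le_neg_iff.1 ?_)
  refine le_of_harmonic_off (f := fun j => -f j) hG l (fun j hj => ?_) i
  rw [neighborAverage_neg, ← hf j hj]

/-- A connected graph decouples the estimator: every robot obeys the equation of the informed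
one. -/
theorem EstimatorEquationAt.decouple {n : ℕ} {G : SimpleGraph (Fin n)} (hG : G.Connected)
    {l : Fin n} {k : ℝ} {η : ℝ → ℝ} {x : Fin n → ℝ → ℝ} {t : ℝ}
    (h : EstimatorEquationAt G l k η x t) (i : Fin n) :
    deriv (x i) t = deriv η t + k * (η t - x i t) := by
  obtain ⟨-, -, h⟩ := h
  have hi := eq_of_harmonic_off (f := fun j => deriv (x j) t + k * x j t) hG l (fun j hj => by
    rw [neighborAverage_add_mul]
    have := h j
    rw [if_neg hj] at this
    linarith) i
  have hl := h l
  rw [if_pos rfl] at hl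
  linarith

/-- Conversely, estimates that all obey the equation of the informed robot solve the estimator. -/
theorem estimatorEquationAt_of_decoupled {n : ℕ} {G : SimpleGraph (Fin n)} (hG : G.Connected)
    {l : Fin n} {k : ℝ} {η : ℝ → ℝ} {x : Fin n → ℝ → ℝ} {t : ℝ} (hη : DifferentiableAt ℝ η t)
    (hx : ∀ i, DifferentiableAt ℝ (x i) t)
    (h : ∀ i, deriv (x i) t = deriv η t + k * (η t - x i t)) :
    EstimatorEquationAt G l k η x t := by
  refine ⟨hη, hx, fun i => ?_⟩
  split_ifs with hi
  · exact h i
  -- A neighbor is needed: over an empty neighborhood the average is `0 / 0 = 0`.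
  · have : Nontrivial (Fin n) := ⟨i, l, hi⟩
    obtain ⟨j, hj⟩ := hG.preconnected.exists_adj_of_nontrivial i
    have e := neighborAverage_add_mul G i k (fun j => deriv (x j) t) (fun j => x j t)
    have c : (fun j => deriv (x j) t + k * x j t) = fun _ => deriv η t + k * η t :=
      funext fun j => by rw [h j]; ring
    rw [c, neighborAverage_const G hj] at e
    rw [h i]
    linarith

/-- A continuous function on `[t₀, ∞)` with `u' = -k u` off a countable set is exponential. -/
theorem eq_mul_exp_of_hasDerivAt_off_countable {u : ℝ → ℝ} {k t₀ : ℝ} {S : Set ℝ}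
    (hS : S.Countable) (hu : ContinuousOn u (Ici t₀))
    (h : ∀ t ∈ Ioi t₀ \ S, HasDerivAt u (-k * u t) t) {t : ℝ} (ht : t₀ ≤ t) :
    u t = u t₀ * Real.exp (-k * (t - t₀)) := by
  -- Integrating factor: this product has zero derivative off `S`, and continuity makes a countable
  -- `S` harmless.
  have hc : ContinuousOn (fun s => u s * Real.exp (k * (s - t₀))) (Icc t₀ t) :=
    (hu.mono Icc_subset_Ici_self).mul (by fun_prop)
  have hd : ∀ s ∈ Ioo t₀ t \ S,
      HasDerivAt (fun s => u s * Real.exp (k * (s - t₀))) 0 s := by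
    intro s hs
    have he : HasDerivAt (fun s => Real.exp (k * (s - t₀)))
        (Real.exp (k * (s - t₀)) * (k * 1)) s :=
      (((hasDerivAt_id s).sub_const t₀).const_mul k).exp
    exact ((h s ⟨hs.1.1, hs.2⟩).mul he).congr_deriv (by ring)
  have hi := MeasureTheory.integral_eq_of_hasDerivAt_off_countable_of_le _ (fun _ => (0 : ℝ)) ht
    hS hc hd intervalIntegrable_const
  simp only [intervalIntegral.integral_zero, sub_self, mul_zero, Real.exp_zero, mul_one] at hi
  rw [← sub_eq_zero.1 hi.symm, mul_assoc, ← Real.exp_add]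
  simp

theorem tendsto_mul_exp_neg_mul_sub {k : ℝ} (hk : 0 < k) (c t₀ : ℝ) :
    Tendsto (fun t => c * Real.exp (-k * (t - t₀))) atTop (𝓝 0) := by
  have h : Tendsto (fun t : ℝ => -k * (t - t₀)) atTop atBot :=
    (tendsto_atTop_add_const_right atTop (-t₀) tendsto_id).const_mul_atTop_of_neg
      (neg_lt_zero.2 hk)
  simpa using (Real.tendsto_exp_atBot.comp h).const_mul c

theorem mainTheorem6 (n : ℕ) (t₀ : ℝ)
    (G : ℝ → SimpleGraph (Fin n)) (hG : ∀ t, t₀ ≤ t → (G t).Connected)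
    (l : Fin n) (k : ℝ) (hk : 0 < k)
    (η : ℝ → ℝ) (hη : ContinuousOn η (Ici t₀))
    (hη' : ∃ S : Set ℝ, S.Countable ∧ ∀ t ∈ Ioi t₀ \ S, DifferentiableAt ℝ η t) :
    (∀ x₀ : Fin n → ℝ, ∃ x : Fin n → ℝ → ℝ,
      IsEstimatorSolution G l k η t₀ x ∧ ∀ i, x i t₀ = x₀ i) ∧
    (∀ x : Fin n → ℝ → ℝ, IsEstimatorSolution G l k η t₀ x →
      ∀ i, Tendsto (fun t => x i t - η t) atTop (𝓝 0)) := by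
  constructor
  · intro x₀
    obtain ⟨S, hS, hd⟩ := hη'
    refine ⟨fun i t => η t + (x₀ i - η t₀) * Real.exp (-k * (t - t₀)),
      ⟨fun i => hη.add (by fun_prop), S, hS, fun t ht => ?_⟩, fun i => by simp⟩
    have hx : ∀ i, HasDerivAt (fun t => η t + (x₀ i - η t₀) * Real.exp (-k * (t - t₀)))
        (deriv η t + (x₀ i - η t₀) * (Real.exp (-k * (t - t₀)) * (-k * 1))) t := fun i =>
      (hd t ht).hasDerivAt.add
        ((((hasDerivAt_id t).sub_const t₀).const_mul (-k)).exp.const_mul _)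
    refine estimatorEquationAt_of_decoupled (hG t (le_of_lt ht.1)) (hd t ht)
      (fun i => (hx i).differentiableAt) fun i => ?_
    rw [(hx i).deriv]
    ring
  · rintro x ⟨hx, S, hS, h⟩ i
    refine (tendsto_mul_exp_neg_mul_sub hk (x i t₀ - η t₀) t₀).congr' ?_
    filter_upwards [eventually_ge_atTop t₀] with t ht
    refine (eq_mul_exp_of_hasDerivAt_off_countable (u := fun t => x i t - η t) hS
      ((hx i).sub hη) (fun s hs => ?_) ht).symm
    have e := h s hs
    refine ((e.2.1 i).hasDerivAt.sub e.1.hasDerivAt).congr_deriv ?_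
    rw [e.decouple (hG s (le_of_lt hs.1)) i]
    ring
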